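/- There is a universal constant $\alpha>0$ such that the following holds. Let $q\ge 1$, let $\mathcal X=\{1,\dots,q\}$ and $\mathcal Y=\{1,\dots,k\}$ be finite alphabets, and let $P_{Y|X}$ be a strictly positive channel from $\mathcal X$ to $\mathcal Y$, i.e. a stochastic $q\times k$ matrix all of whose entries $P_{Y|X}(y|x)$ are positive. Put $$c_*=\min_{y\in\mathcal Y}\frac{\min_{x\in\mathcal X}P_{Y|X}(y|x)}{\max_{x\in\mathcal X}P_{Y|X}(y|x)}.$$ Then there is a constant $c\ge 0$, depending only on $P_{Y|X}$, with $$c\le\frac{q-1}{2}\log\frac{2\pi\alpha^2}{c_*}+\frac{q}{12},$$ such that for every $n\ge1$, every $n$-type $P$ (a probability distribution on $\mathcal X$ all of whose probabilities are integer multiples of $1/n$) and every probability distribution $Q_Y$ on $\mathcal Y$, $$n\,D(P_Y\|Q_Y)\;\le\; D(P_{Y|X}^n\circ U\,\|\,Q_Y^n)\;\le\; n\,D(P_Y\|Q_Y)+c .$$ Here $D\in[0,\infty]$ is the Kullback–Leibler divergence (natural logarithm); $P_Y(y)=\sum_xP(x)P_{Y|X}(y|x)$ is the output marginal; $U$ is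 the uniform distribution on the type class $T_n(P)\subseteq\mathcal X^n$ of all sequences in which each letter $a$ occurs exactly $nP(a)$ times; $P_{Y|X}^n\circ U$ is the law on $\mathcal Y^n$ of the output when a sequence drawn from $U$ is passed letter by letter, independently, through $P_{Y|X}$; and $Q_Y^n$ is the $n$-fold product of $Q_Y$. -/

import Mathlib

open MeasureTheory ProbabilityTheory InformationTheory
open scoped NNReal ENNReal

/-- `P` is an `n`-type on the alphabet `Fin q` (used for probability measures and `n ≥ 1`):
every probability is a fraction with denominator `n`. -/
def IsNType {q : ℕ} (n : ℕ) (P : Measure (Fin q)) : Prop :=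
  ∀ a : Fin q, ∃ m : ℕ, P.real {a} = (m : ℝ) / (n : ℝ)

/-- The type class `T_n(P)`: the sequences of length `n` whose empirical distribution is `P`. -/
def typeClass {q : ℕ} (n : ℕ) (P : Measure (Fin q)) : Set (Fin n → Fin q) :=
  {x | ∀ a : Fin q, ((Finset.univ.filter (fun t : Fin n => x t = a)).card : ℝ) / (n : ℝ)
    = P.real {a}}

/-- The `n`-fold memoryless use of the channel `W`: given the input sequence `x`, the output
symbols are independent and the `t`-th one has law `W (x t)`. -/
noncomputable def channelPow {q k : ℕ} (W : Kernel (Fin q) (Fin k)) (n : ℕ) :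
    Kernel (Fin n → Fin q) (Fin n → Fin k) where
  toFun x := Measure.pi (fun t : Fin n => W (x t))
  measurable' := Measurable.of_discrete

/-- The number `c_*`: the minimum, over the output letters `y`, of the ratio between the smallest
and the largest of the transition probabilities into `y`. -/
noncomputable def minRatio {q k : ℕ} (W : Kernel (Fin q) (Fin k)) : ℝ :=
  ⨅ y : Fin k, (⨅ x : Fin q, (W x).real {y}) / (⨆ x : Fin q, (W x).real {y})

/-! Let `R` be the output law for a uniform input from the type class. The log-ratio of the product
laws of `W ∘ₘ P` and `Q` is a sum over letters, and its mean under `R` depends only on the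
composition (`sum_channelPow_comp_uniformOn`). Hence D(R‖Qⁿ) = n D(P_Y‖Q) + D(R‖P_Yⁿ). The lower
bound is nonnegativity of the last term; the upper bound follows from a pointwise estimate R(y) ≤
e^C P_Yⁿ(y).

For fixed y, Bayes' rule turns R(y)/P_Yⁿ(y) into the probability that independent letters, with
posterior laws proportional to N_a W(y_t|a), have composition N, divided by the probability of the
type class under Pⁿ. `sum_wordsWithCounts_le` bounds the numerator by peeling off one letter at a
time: each count is a sum of independent Bernoulli variables, so `poissonBinomial_le` costs one
inverse standard deviation, and c_* keeps the variance large. `stirling_card_wordsWithCounts` bounds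
the denominator from below. The factors √n/∏√N_a cancel, which leaves a constant independent of n
and P. -/

/-! ### Point probabilities of Bernoulli sums, by Fourier inversion -/

/-- The squared modulus is 1 − 2p(1−p)(1 − cos θ); then use cos θ ≤ 1 − 2θ²/π² on [−π, π] and 1 + x
≤ eˣ. -/
theorem norm_bernoulli_char_le (p θ : ℝ) (h0 : 0 ≤ p) (h1 : p ≤ 1) (hθ : |θ| ≤ Real.pi) :
    ‖(p : ℂ) * Complex.exp (θ * Complex.I) + (1 - p : ℝ)‖
      ≤ Real.exp (-(2 / Real.pi ^ 2 * θ ^ 2) * (p * (1 - p))) := by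
  have hsq : ‖(p : ℂ) * Complex.exp (θ * Complex.I) + (1 - p : ℝ)‖ ^ 2
      = 1 - 2 * (p * (1 - p)) * (1 - Real.cos θ) := by
    rw [← Complex.normSq_eq_norm_sq, Complex.normSq_apply]
    simp only [Complex.add_re, Complex.add_im, Complex.mul_re, Complex.mul_im, Complex.ofReal_re,
      Complex.ofReal_im, Complex.exp_ofReal_mul_I_re, Complex.exp_ofReal_mul_I_im]
    linear_combination p ^ 2 * Real.sin_sq_add_cos_sq θ
  refine abs_le_of_sq_le_sq' ?_ (Real.exp_pos _).le |>.2
  rw [hsq, ← Real.exp_nat_mul]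
  have hc := Real.cos_le_one_sub_mul_cos_sq hθ
  have hv : 0 ≤ p * (1 - p) := mul_nonneg h0 (by linarith)
  refine le_trans ?_ (Real.add_one_le_exp _)
  push_cast
  nlinarith [mul_le_mul_of_nonneg_left hc hv]

theorem integral_exp_int_mul_I (m : ℤ) :
    ∫ θ in (-Real.pi)..Real.pi, Complex.exp (m * (θ * Complex.I))
      = if m = 0 then 2 * (Real.pi : ℂ) else 0 := by
  split_ifs with h
  · subst h
    simp
    ring
  · have hm : (m : ℂ) * Complex.I ≠ 0 := mul_ne_zero (by exact_mod_cast h) Complex.I_ne_zero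
    have := integral_exp_mul_complex (a := -Real.pi) (b := Real.pi) hm
    have e : ∀ θ : ℝ, (m : ℂ) * (θ * Complex.I) = m * Complex.I * θ := fun θ => by ring
    simp_rw [e]
    rw [this, div_eq_zero_iff, sub_eq_zero]
    left
    rw [Complex.exp_eq_exp_iff_exists_int]
    exact ⟨m, by push_cast; ring⟩

/-- Point probabilities of a sum of independent Bernoulli variables are at most the inverse of the
standard deviation. -/
theorem poissonBinomial_le {ι : Type*} [Fintype ι] [DecidableEq ι] (p : ι → ℝ)
    (h0 : ∀ i, 0 ≤ p i) (h1 : ∀ i, p i ≤ 1) (r : ℕ) (hσ : 0 < ∑ i, p i * (1 - p i)) :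
    ∑ s ∈ Finset.powersetCard r Finset.univ, (∏ i ∈ s, p i) * ∏ i ∈ sᶜ, (1 - p i)
      ≤ 1 / √(∑ i, p i * (1 - p i)) := by
  set V := ∑ i, p i * (1 - p i) with hV
  set S := ∑ s ∈ Finset.powersetCard r (Finset.univ : Finset ι),
    (∏ i ∈ s, p i) * ∏ i ∈ sᶜ, (1 - p i) with hS
  -- The characteristic function of the sum, twisted so that integration over a period extracts the
  -- probability of the value r.
  set F : ℝ → ℂ := fun θ =>
    (∏ i, ((p i : ℂ) * Complex.exp (θ * Complex.I) + (1 - p i : ℝ)))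
      * Complex.exp (-(r : ℂ) * (θ * Complex.I)) with hF
  have hexp : ∀ θ, F θ = ∑ s : Finset ι, (((∏ i ∈ s, p i) * ∏ i ∈ sᶜ, (1 - p i) : ℝ) : ℂ)
      * Complex.exp (((s.card : ℤ) - (r : ℤ) : ℤ) * (θ * Complex.I)) := by
    intro θ
    simp only [hF]
    rw [Fintype.prod_add, Finset.sum_mul]
    refine Finset.sum_congr rfl fun s _ => ?_
    rw [Finset.prod_mul_distrib, Finset.prod_const, ← Complex.exp_nat_mul]
    push_cast
    rw [sub_mul, Complex.exp_sub, neg_mul, Complex.exp_neg]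
    ring
  have hint : ∫ θ in (-Real.pi)..Real.pi, F θ = 2 * Real.pi * S := by
    simp_rw [hexp]
    rw [intervalIntegral.integral_finsetSum]
    · simp_rw [intervalIntegral.integral_const_mul, integral_exp_int_mul_I]
      rw [hS, Finset.powersetCard_eq_filter, Finset.powerset_univ, Finset.sum_filter]
      push_cast
      rw [Finset.mul_sum]
      refine Finset.sum_congr rfl fun s _ => ?_
      by_cases h : s.card = r
      · simp [h]; ring
      · have : (s.card : ℤ) - r ≠ 0 := by omega
        simp [h, this]
    · intro s _
      apply Continuous.intervalIntegrable
      fun_prop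
  have hb : 0 < 2 / Real.pi ^ 2 * V := by positivity
  have hbound : ‖∫ θ in (-Real.pi)..Real.pi, F θ‖ ≤ √(Real.pi / (2 / Real.pi ^ 2 * V)) := by
    calc _ ≤ ∫ θ in (-Real.pi)..Real.pi, Real.exp (-(2 / Real.pi ^ 2 * V) * θ ^ 2) := by
          apply intervalIntegral.norm_integral_le_of_norm_le (by linarith [Real.pi_pos])
          · refine Filter.Eventually.of_forall fun θ hθ => ?_
            have hθ' : |θ| ≤ Real.pi := abs_le.2 ⟨hθ.1.le, hθ.2⟩
            have e1 : ‖Complex.exp (-(r : ℂ) * (θ * Complex.I))‖ = 1 := by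
              rw [Complex.norm_exp]; simp
            simp only [hF, norm_mul, norm_prod, e1, mul_one]
            calc _ ≤ ∏ i, Real.exp (-(2 / Real.pi ^ 2 * θ ^ 2) * (p i * (1 - p i))) :=
                  Finset.prod_le_prod (fun _ _ => norm_nonneg _)
                    fun i _ => norm_bernoulli_char_le (p i) θ (h0 i) (h1 i) hθ'
              _ = _ := by
                rw [← Real.exp_sum, ← Finset.mul_sum, ← hV]
                congr 1; ring
          · apply Continuous.intervalIntegrable
            fun_prop
      _ ≤ ∫ θ : ℝ, Real.exp (-(2 / Real.pi ^ 2 * V) * θ ^ 2) := by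
          rw [intervalIntegral.integral_of_le (by linarith [Real.pi_pos])]
          exact setIntegral_le_integral (integrable_exp_neg_mul_sq hb)
            (Filter.Eventually.of_forall fun _ => (Real.exp_pos _).le)
      _ = _ := integral_gaussian _
  have hS0 : 0 ≤ S := Finset.sum_nonneg fun s _ => mul_nonneg
    (Finset.prod_nonneg fun i _ => h0 i) (Finset.prod_nonneg fun i _ => by linarith [h1 i])
  have hnorm : ‖∫ θ in (-Real.pi)..Real.pi, F θ‖ = 2 * Real.pi * S := by
    rw [hint, ← Complex.ofReal_ofNat, ← Complex.ofReal_mul, ← Complex.ofReal_mul,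
      Complex.norm_real, Real.norm_of_nonneg (by positivity)]
  rw [hnorm] at hbound
  -- After squaring, this is π³/2 ≤ 4π², that is π ≤ 8.
  have h2 : √(Real.pi / (2 / Real.pi ^ 2 * V)) ≤ 2 * Real.pi * (1 / √V) := by
    rw [Real.sqrt_le_left (by positivity), mul_pow, div_pow, Real.sq_sqrt hσ.le]
    rw [div_le_iff₀ hb]
    have : (2 * Real.pi) ^ 2 * (1 ^ 2 / V) * (2 / Real.pi ^ 2 * V) = 8 := by field_simp; norm_num
    linarith [Real.pi_le_four]
  exact le_of_mul_le_mul_left (hbound.trans h2) (by positivity)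

/-! ### Probability of a composition, one letter at a time -/

/-- With H = M w, the variance is NM·gw/(Ng + Mw)². Replacing the smaller of g and w in the
denominator by the larger leaves NM/(N+M)² times their ratio, which is at least c. -/
theorem bernoulli_variance_ge {c N M g H : ℝ} (hN : 0 < N) (hM : 0 < M) (hg : 0 < g)
    (hc : 0 ≤ c) (hH : 0 < H) (h1 : c * H ≤ M * g) (h2 : c * (M * g) ≤ H) :
    c * (N * M / (N + M) ^ 2)
      ≤ N * g / (N * g + H) * (1 - N * g / (N * g + H)) := by
  obtain ⟨w, rfl⟩ : ∃ w, H = M * w := ⟨H / M, by field_simp⟩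
  have hw : 0 < w := pos_of_mul_pos_right hH hM.le
  have h1' : c * w ≤ g := by
    refine le_of_mul_le_mul_left ?_ hM; linarith
  have h2' : c * g ≤ w := by
    refine le_of_mul_le_mul_left ?_ hM; linarith
  have hpos : 0 < N * g + M * w := by positivity
  have e : N * g / (N * g + M * w) * (1 - N * g / (N * g + M * w))
      = N * M * (g * w) / (N * g + M * w) ^ 2 := by
    field_simp; ring
  rw [e, ← mul_div_assoc, div_le_div_iff₀ (by positivity) (by positivity)]
  have key : c * (N * g + M * w) ^ 2 ≤ g * w * (N + M) ^ 2 := by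
    rcases le_total g w with h | h
    · calc c * (N * g + M * w) ^ 2 ≤ c * (N * w + M * w) ^ 2 := by gcongr
        _ = (c * w) * (w * (N + M) ^ 2) := by ring
        _ ≤ g * (w * (N + M) ^ 2) := by gcongr
        _ = _ := by ring
    · calc c * (N * g + M * w) ^ 2 ≤ c * (N * g + M * g) ^ 2 := by gcongr
        _ = (c * g) * (g * (N + M) ^ 2) := by ring
        _ ≤ w * (g * (N + M) ^ 2) := by gcongr
        _ = _ := by ring
  nlinarith [mul_le_mul_of_nonneg_left key (mul_pos hN hM).le]

/-- The functions `ι → κ` with values in `A` that take each value `a ∈ A` exactly `N a` times. -/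
def wordsWithCounts (ι : Type*) {κ : Type*} [Fintype ι] [DecidableEq ι] [DecidableEq κ]
    (A : Finset κ) (N : κ → ℕ) : Finset (ι → κ) :=
  (Fintype.piFinset fun _ => A).filter
    fun x => ∀ a ∈ A, (Finset.univ.filter fun t => x t = a).card = N a

theorem mem_wordsWithCounts {ι κ : Type*} [Fintype ι] [DecidableEq ι] [DecidableEq κ]
    {A : Finset κ} {N : κ → ℕ} {x : ι → κ} :
    x ∈ wordsWithCounts ι A N ↔
      (∀ t, x t ∈ A) ∧ ∀ a ∈ A, (Finset.univ.filter fun t => x t = a).card = N a := by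
  simp [wordsWithCounts]

/-- Sort the words by the set s of positions holding a; restricting to the complement of s is
injective on each class, and its image lies among the words over A. -/
theorem sum_wordsWithCounts_cons_le {ι κ : Type*} [Fintype ι] [DecidableEq ι] [DecidableEq κ]
    (A : Finset κ) (N : κ → ℕ) (a : κ) (ha : a ∉ A) (f : ι → κ → ℝ)
    (hf : ∀ t, ∀ b ∈ Finset.cons a A ha, 0 ≤ f t b) :
    ∑ x ∈ wordsWithCounts ι (Finset.cons a A ha) N, ∏ t, f t (x t) ≤
      ∑ s ∈ Finset.powersetCard (N a) Finset.univ,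
        (∏ t ∈ s, f t a) *
          ∑ x ∈ wordsWithCounts ↥(sᶜ) A N, ∏ t : ↥(sᶜ), f t (x t) := by
  classical
  rw [← Finset.sum_fiberwise_of_maps_to (s := wordsWithCounts ι (Finset.cons a A ha) N)
    (t := Finset.powersetCard (N a) Finset.univ)
    (g := fun x => Finset.univ.filter fun t => x t = a)]
  swap
  · intro x hx
    simpa [Finset.mem_powersetCard] using
      (mem_wordsWithCounts.1 hx).2 a (Finset.mem_cons_self a A)
  refine Finset.sum_le_sum fun s _ => ?_
  set B := (wordsWithCounts ι (Finset.cons a A ha) N).filter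
    fun x => (Finset.univ.filter fun t => x t = a) = s with hB
  have hBs : ∀ x ∈ B, ∀ t, x t = a ↔ t ∈ s := by
    intro x hx t
    rw [← (Finset.mem_filter.1 hx).2]; simp
  have hBA : ∀ x ∈ B, (∀ t, x t ∈ Finset.cons a A ha) ∧
      ∀ b ∈ Finset.cons a A ha, (Finset.univ.filter fun t => x t = b).card = N b :=
    fun x hx => mem_wordsWithCounts.1 (Finset.mem_filter.1 hx).1
  let R : (ι → κ) → (↥(sᶜ) → κ) := fun x t => x t
  have hinj : Set.InjOn R B := by
    intro x hx y hy h
    ext t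
    by_cases ht : t ∈ s
    · rw [(hBs x hx t).2 ht, (hBs y hy t).2 ht]
    · exact congrFun h ⟨t, by simpa using ht⟩
  have hprod : ∀ x ∈ B, ∏ t, f t (x t) = (∏ t ∈ s, f t a) * ∏ t : ↥(sᶜ), f t (R x t) := by
    intro x hx
    rw [← Finset.prod_mul_prod_compl s, Finset.prod_coe_sort (sᶜ) fun t => f t (x t)]
    congr 1
    exact Finset.prod_congr rfl fun t ht => by rw [(hBs x hx t).2 ht]
  rw [Finset.sum_congr rfl hprod, ← Finset.mul_sum]
  refine mul_le_mul_of_nonneg_left ?_ (Finset.prod_nonneg fun t _ => hf t a (by simp))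
  rw [← Finset.sum_image (f := fun y : ↥(sᶜ) → κ => ∏ t : ↥(sᶜ), f t (y t)) hinj]
  refine Finset.sum_le_sum_of_subset_of_nonneg ?_ ?_
  · intro y hy
    obtain ⟨x, hx, rfl⟩ := Finset.mem_image.1 hy
    obtain ⟨h1, h2⟩ := hBA x hx
    refine mem_wordsWithCounts.2 ⟨fun t => ?_, fun b hb => ?_⟩
    · refine (Finset.mem_cons.1 (h1 t)).resolve_left fun h => ?_
      have := t.2
      rw [Finset.mem_compl] at this
      exact this ((hBs x hx t).1 h)
    · rw [← h2 b (Finset.mem_cons_of_mem hb)]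
      have hba : b ≠ a := fun h => ha (h ▸ hb)
      refine Finset.card_bij (fun t _ => t.1) (fun t ht => by simpa [R] using ht)
        (fun t _ t' _ h => Subtype.ext h) fun t ht => ?_
      have ht' : x t = b := by simpa using ht
      refine ⟨⟨t, ?_⟩, by simpa [R] using ht', rfl⟩
      rw [Finset.mem_compl, ← hBs x hx t, ht']
      exact hba
  · intro y hy _
    exact Finset.prod_nonneg fun t _ =>
      hf t _ (Finset.mem_cons_of_mem ((mem_wordsWithCounts.1 hy).1 t))

/-- Divided by the last product, the left side is the probability that independent letters with
weights N_b g_t(b) have composition N. The index type and g are quantified after A because the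
induction step passes to the complement of the positions of a. -/
theorem sum_wordsWithCounts_le {κ : Type*} [DecidableEq κ] (N : κ → ℕ) (c : ℝ) (hc : 0 < c)
    (A : Finset κ) (hA : A.Nonempty) (hN : ∀ a ∈ A, 0 < N a) :
    ∀ (ι : Type) [Fintype ι] [DecidableEq ι] (g : ι → κ → ℝ),
      (∀ t, ∀ a ∈ A, 0 < g t a) → (∀ t, ∀ a ∈ A, ∀ b ∈ A, c * g t b ≤ g t a) →
      ∑ a ∈ A, N a = Fintype.card ι →
      ∑ x ∈ wordsWithCounts ι A N, ∏ t, ((N (x t) : ℝ) * g t (x t)) ≤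
        (1 / √c) ^ (A.card - 1) * (√(Fintype.card ι) / ∏ a ∈ A, √(N a)) *
          ∏ t, ∑ a ∈ A, (N a : ℝ) * g t a := by
  induction hA using Finset.Nonempty.cons_induction with
  | singleton a =>
    intro ι _ _ g hg _ hcard
    have hNa := hN a (by simp)
    have hsub : wordsWithCounts ι {a} N ⊆ {fun _ => a} := by
      intro x hx
      have := (mem_wordsWithCounts.1 hx).1
      simp only [Finset.mem_singleton] at this ⊢
      exact funext this
    have hcard' : N a = Fintype.card ι := by simpa using hcard
    have hs : √(N a : ℝ) ≠ 0 := by positivity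
    refine (Finset.sum_le_sum_of_subset_of_nonneg hsub ?_).trans ?_
    · intro x hx _
      rw [Finset.mem_singleton.1 hx]
      exact Finset.prod_nonneg fun t _ => mul_nonneg (Nat.cast_nonneg _) (hg t a (by simp)).le
    · simp [← hcard', hs]
  | cons a A ha hA ih =>
    intro ι _ _ g hg hcg hcard
    have hNa : (0 : ℝ) < N a := by exact_mod_cast hN a (by simp)
    have hNA : ∀ b ∈ A, 0 < N b := fun b hb => hN b (Finset.mem_cons_of_mem hb)
    have hgA : ∀ t, ∀ b ∈ A, 0 < g t b := fun t b hb => hg t b (Finset.mem_cons_of_mem hb)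
    have hga : ∀ t, 0 < g t a := fun t => hg t a (by simp)
    rw [Finset.sum_cons] at hcard
    set M := ∑ b ∈ A, N b with hM
    have hMpos : (0 : ℝ) < M := by
      have : 0 < M := Finset.sum_pos hNA hA
      exact_mod_cast this
    have hm : (Fintype.card ι : ℝ) = N a + M := by rw [← hcard]; push_cast; rfl
    refine (sum_wordsWithCounts_cons_le A N a ha (fun t b => (N b : ℝ) * g t b)
      fun t b hb => mul_nonneg (Nat.cast_nonneg _) (hg t b hb).le).trans ?_
    set H : ι → ℝ := fun t => ∑ b ∈ A, (N b : ℝ) * g t b with hH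
    have hHpos : ∀ t, 0 < H t := fun t => Finset.sum_pos
      (fun b hb => mul_pos (by exact_mod_cast hNA b hb) (hgA t b hb)) hA
    set p : ι → ℝ := fun t => N a * g t a / (N a * g t a + H t) with hp
    have hden : ∀ t, 0 < N a * g t a + H t := fun t => by
      have := hHpos t; have := hga t; positivity
    have h1p : ∀ t, 1 - p t = H t / (N a * g t a + H t) := fun t => by
      have := (hden t).ne'; simp only [hp]; field_simp; ring
    have hp0 : ∀ t, 0 ≤ p t := fun t => div_nonneg (mul_pos hNa (hga t)).le (hden t).le
    have hp1 : ∀ t, p t ≤ 1 := fun t => by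
      have := div_nonneg (hHpos t).le (hden t).le
      linarith [h1p t]
    set D := (1 / √c) ^ (A.card - 1) * (√(M : ℝ) / ∏ b ∈ A, √(N b)) with hD
    have hD0 : 0 ≤ D := by positivity
    -- There are n = N a + M positions, which cancels one factor of the square in
    -- `bernoulli_variance_ge`.
    have hvar : c * (N a * M / (N a + M)) ≤ ∑ t, p t * (1 - p t) := by
      calc c * ((N a : ℝ) * M / (N a + M))
          = ∑ t : ι, c * ((N a : ℝ) * M / (N a + M) ^ 2) := by
            rw [Finset.sum_const, Finset.card_univ, nsmul_eq_mul, hm]; field_simp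
        _ ≤ _ := by
          refine Finset.sum_le_sum fun t _ =>
            bernoulli_variance_ge hNa hMpos (hga t) hc.le (hHpos t) ?_ ?_
          · rw [hH, hM, Finset.mul_sum]; push_cast; rw [Finset.sum_mul]
            refine Finset.sum_le_sum fun b hb => ?_
            have := hcg t a (by simp) b (Finset.mem_cons_of_mem hb)
            nlinarith [(Nat.cast_nonneg (N b) : (0 : ℝ) ≤ N b)]
          · rw [hH, hM]; push_cast; rw [Finset.sum_mul, Finset.mul_sum]
            refine Finset.sum_le_sum fun b hb => ?_
            have := hcg t b (Finset.mem_cons_of_mem hb) a (by simp)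
            nlinarith [(Nat.cast_nonneg (N b) : (0 : ℝ) ≤ N b)]
    have hlow : 0 < c * ((N a : ℝ) * M / (N a + M)) := by positivity
    have hpb := poissonBinomial_le p hp0 hp1 (N a) (hlow.trans_le hvar)
    have hpb' := hpb.trans (one_div_le_one_div_of_le (Real.sqrt_pos.2 hlow)
      (Real.sqrt_le_sqrt hvar))
    have hprodnn : 0 ≤ ∏ t, (N a * g t a + H t) := Finset.prod_nonneg fun t _ => (hden t).le
    calc _ ≤ ∑ s ∈ Finset.powersetCard (N a) (Finset.univ : Finset ι),
          (∏ t ∈ s, (N a : ℝ) * g t a) * (D * ∏ t ∈ sᶜ, H t) := by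
          refine Finset.sum_le_sum fun s hs => mul_le_mul_of_nonneg_left ?_
            (Finset.prod_nonneg fun t _ => (mul_pos hNa (hga t)).le)
          have hsc : Fintype.card ↥(sᶜ) = M := by
            rw [Fintype.card_coe, Finset.card_compl, (Finset.mem_powersetCard.1 hs).2]; omega
          have := ih hNA ↥(sᶜ) (fun t b => g t b) (fun t => hgA t)
            (fun t b hb b' hb' => hcg t b (Finset.mem_cons_of_mem hb) b'
              (Finset.mem_cons_of_mem hb')) hsc.symm
          rw [hsc] at this
          rwa [Finset.prod_coe_sort (sᶜ) H] at this
      -- Normalizing each position turns the sum into the probability that a Bernoulli sum equals N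
      -- a.
      _ = D * (∏ t, (N a * g t a + H t)) *
          ∑ s ∈ Finset.powersetCard (N a) (Finset.univ : Finset ι),
            (∏ t ∈ s, p t) * ∏ t ∈ sᶜ, (1 - p t) := by
          rw [Finset.mul_sum]
          refine Finset.sum_congr rfl fun s _ => ?_
          simp_rw [h1p]
          rw [← Finset.prod_mul_prod_compl s, hp, Finset.prod_div_distrib,
            Finset.prod_div_distrib]
          have e1 : ∏ t ∈ s, (N a * g t a + H t) ≠ 0 :=
            Finset.prod_ne_zero_iff.2 fun t _ => (hden t).ne'
          have e2 : ∏ t ∈ sᶜ, (N a * g t a + H t) ≠ 0 :=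
            Finset.prod_ne_zero_iff.2 fun t _ => (hden t).ne'
          field_simp
      _ ≤ D * (∏ t, (N a * g t a + H t)) * (1 / √(c * ((N a : ℝ) * M / (N a + M)))) := by
          gcongr
      -- The new factor √(N a + M)/(√c √(N a) √M) cancels the √M of the induction hypothesis, so the
      -- bounds telescope.
      _ = _ := by
          rw [hD, hm, Finset.card_cons, Finset.prod_cons, Nat.add_sub_cancel]
          simp_rw [Finset.sum_cons]
          obtain ⟨d, hd⟩ : ∃ d, A.card = d + 1 :=
            ⟨A.card - 1, by have := hA.card_pos; omega⟩
          rw [hd, Nat.add_sub_cancel, pow_succ, Real.sqrt_mul hc.le,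
            Real.sqrt_div' _ (by positivity), Real.sqrt_mul hNa.le]
          have q1 : √(M : ℝ) ≠ 0 := by positivity
          have q2 : √(N a : ℝ) ≠ 0 := by positivity
          have q3 : √((N a : ℝ) + M) ≠ 0 := by positivity
          have q4 : √c ≠ 0 := by positivity
          have q5 : ∏ b ∈ A, √(N b : ℝ) ≠ 0 := Finset.prod_ne_zero_iff.2 fun b hb => by
            have := hNA b hb; positivity
          field_simp
          simp only [hH]

/-! ### Stirling bounds and the size of a type class -/

/-- The sequence decreases, so its first value e/√2 decides; the claim becomes e¹¹ ≤ (2π)⁶. -/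
theorem stirlingSeq_le (n : ℕ) (hn : 0 < n) :
    Stirling.stirlingSeq n ≤ √Real.pi * Real.exp (1 / 12) := by
  obtain ⟨m, rfl⟩ : ∃ m, n = m + 1 := ⟨n - 1, by omega⟩
  refine (Stirling.stirlingSeq'_antitone (Nat.zero_le m)).trans ?_
  simp only [Function.comp, Nat.succ_eq_add_one, zero_add, Stirling.stirlingSeq_one]
  rw [div_le_iff₀ (by positivity), mul_right_comm, ← Real.sqrt_mul Real.pi_pos.le]
  have h : Real.exp (11 / 12) ≤ √(Real.pi * 2) := by
    refine Real.le_sqrt_of_sq_le ?_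
    refine le_of_pow_le_pow_left₀ (n := 6) (by norm_num) (by positivity) ?_
    rw [← pow_mul, ← Real.exp_nat_mul]
    have e : ((2 * 6 : ℕ) : ℝ) * (11 / 12) = (11 : ℕ) * 1 := by norm_num
    rw [e, Real.exp_nat_mul]
    calc Real.exp 1 ^ 11 ≤ 2.7182818286 ^ 11 := by gcongr; exact Real.exp_one_lt_d9.le
      _ ≤ (3.14 * 2) ^ 6 := by norm_num
      _ ≤ _ := by gcongr; exact Real.pi_gt_d2.le
  calc Real.exp 1 = Real.exp (11 / 12) * Real.exp (1 / 12) := by rw [← Real.exp_add]; norm_num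
    _ ≤ _ := by gcongr

theorem factorial_le_stirling (n : ℕ) (hn : 0 < n) :
    (n.factorial : ℝ) ≤ √(2 * Real.pi * n) * (n / Real.exp 1) ^ n * Real.exp (1 / 12) := by
  have h := stirlingSeq_le n hn
  have hn' : (0 : ℝ) < n := by exact_mod_cast hn
  rw [Stirling.stirlingSeq, div_le_iff₀ (by positivity)] at h
  refine h.trans_eq ?_
  have : √(2 * Real.pi * n) = √Real.pi * √((2 * n : ℕ) : ℝ) := by
    rw [← Real.sqrt_mul Real.pi_pos.le]; congr 1; push_cast; ring
  rw [this]
  push_cast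
  ring

/-- Permutations act on one word of the given composition; each fibre of the orbit map has at most
as many elements as the stabilizer, namely ∏ N_a!. -/
theorem factorial_le_card_mul {ι κ : Type*} [Fintype ι] [DecidableEq ι] [Fintype κ]
    [DecidableEq κ] (N : κ → ℕ) (hN : ∑ a, N a = Fintype.card ι) :
    (Fintype.card ι).factorial ≤
      (Finset.univ.filter fun x : ι → κ =>
        ∀ a, (Finset.univ.filter fun t => x t = a).card = N a).card * ∏ a, (N a).factorial := by
  obtain ⟨e⟩ : Nonempty (ι ≃ Σ a, Fin (N a)) := by
    rw [← Fintype.card_eq]; simp [hN]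
  set x₀ : ι → κ := fun t => (e t).1 with hx₀
  have hc : ∀ (g : Equiv.Perm ι) a, (Finset.univ.filter fun t => x₀ (g t) = a).card = N a := by
    intro g a
    rw [← Fintype.card_subtype, ← Fintype.card_fin (N a)]
    refine Fintype.card_congr ((Equiv.subtypeEquiv (q := fun s : Σ a, Fin (N a) => s.1 = a)
      (g.trans e) fun t => Iff.rfl).trans (Equiv.sigmaSubtype a))
  rw [← Fintype.card_perm, ← Finset.card_univ, mul_comm]
  refine Finset.card_le_mul_card_image_of_maps_to (f := fun g : Equiv.Perm ι => x₀ ∘ g)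
    (fun g _ => by simpa using hc g) _ ?_
  intro x _
  by_cases hx : ∃ g₀ : Equiv.Perm ι, x₀ ∘ g₀ = x
  · obtain ⟨g₀, rfl⟩ := hx
    have := DomMulAct.stabilizer_card x₀
    have hs : ∀ a, Fintype.card {t // x₀ t = a} = N a := fun a => by
      rw [Fintype.card_subtype]; exact hc 1 a
    simp_rw [hs] at this
    rw [← this, ← Fintype.card_subtype]
    -- Right translation by g₀⁻¹ carries the fibre into the stabilizer.
    refine Fintype.card_le_of_injective
      (fun g => ⟨g.1 * g₀⁻¹, ?_⟩) ?_
    · have := g.2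
      ext t
      have := congrFun this (g₀⁻¹ t)
      simpa using this
    · intro g g' h
      simpa [Subtype.ext_iff] using h
  · push Not at hx
    rw [Finset.filter_false_of_mem (by simpa using hx)]
    simp

theorem prod_comp_of_mem_wordsWithCounts {ι κ : Type*} [Fintype ι] [DecidableEq ι]
    [DecidableEq κ] {A : Finset κ} {N : κ → ℕ} {x : ι → κ} (hx : x ∈ wordsWithCounts ι A N)
    (f : κ → ℝ) : ∏ t, f (x t) = ∏ a ∈ A, f a ^ N a := by
  obtain ⟨h1, h2⟩ := mem_wordsWithCounts.1 hx
  rw [← Finset.prod_fiberwise_of_maps_to (t := A) (g := x) (fun t _ => h1 t)]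
  refine Finset.prod_congr rfl fun a ha => ?_
  rw [← h2 a ha, ← Finset.prod_const]
  exact Finset.prod_congr rfl fun t ht => by rw [(Finset.mem_filter.1 ht).2]

/-- The powers of e cancel because the counts sum to n, and the √(2π) from n! removes one of the
`A.card` such factors. -/
theorem stirling_card_wordsWithCounts {ι κ : Type*} [Fintype ι] [DecidableEq ι] [Fintype κ]
    [DecidableEq κ] (N : κ → ℕ) (A : Finset κ) (hA : A.Nonempty) (hNA : ∀ a, a ∈ A ↔ 0 < N a)
    (hN : ∑ a, N a = Fintype.card ι) :
    √(Fintype.card ι) * (Fintype.card ι : ℝ) ^ Fintype.card ι ≤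
      (wordsWithCounts ι A N).card * (√(2 * Real.pi) ^ (A.card - 1) *
        (∏ a ∈ A, √(N a)) * (∏ a ∈ A, (N a : ℝ) ^ N a) * Real.exp (A.card / 12)) := by
  set n := Fintype.card ι with hn
  have hNz : ∀ a, a ∉ A → N a = 0 := fun a ha => by
    by_contra h; exact ha ((hNA a).2 (Nat.pos_of_ne_zero h))
  have hset : (Finset.univ.filter fun x : ι → κ =>
      ∀ a, (Finset.univ.filter fun t => x t = a).card = N a) ⊆ wordsWithCounts ι A N := by
    intro x hx
    have hx := (Finset.mem_filter.1 hx).2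
    refine mem_wordsWithCounts.2 ⟨fun t => (hNA _).2 ?_, fun a _ => hx a⟩
    rw [← hx (x t), Finset.card_pos]
    exact ⟨t, by simp⟩
  have h1 : (n.factorial : ℝ) ≤ (wordsWithCounts ι A N).card * ∏ a ∈ A, ((N a).factorial : ℝ) := by
    have := (factorial_le_card_mul N hN).trans
      (Nat.mul_le_mul_right _ (Finset.card_le_card hset))
    rw [← Finset.prod_subset (Finset.subset_univ A) fun a _ ha => by simp [hNz a ha]] at this
    exact_mod_cast this
  have hsumA : ∑ a ∈ A, N a = n := by
    rw [← hN]
    exact Finset.sum_subset (Finset.subset_univ A) fun a _ ha => hNz a ha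
  have h2 : ∏ a ∈ A, ((N a).factorial : ℝ) ≤ √(2 * Real.pi) ^ A.card *
      (∏ a ∈ A, √(N a)) * (∏ a ∈ A, (N a : ℝ) ^ N a) * Real.exp (A.card / 12)
        / Real.exp 1 ^ n := by
    calc ∏ a ∈ A, ((N a).factorial : ℝ)
        ≤ ∏ a ∈ A, (√(2 * Real.pi) * √(N a) * ((N a : ℝ) ^ N a) * Real.exp (1 / 12)
            / Real.exp 1 ^ N a) := by
          refine Finset.prod_le_prod (fun _ _ => Nat.cast_nonneg _) fun a ha => ?_
          refine (factorial_le_stirling (N a) ((hNA a).1 ha)).trans_eq ?_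
          rw [Real.sqrt_mul (by positivity), div_pow]; ring
      _ = _ := by
          rw [Finset.prod_div_distrib, Finset.prod_mul_distrib, Finset.prod_mul_distrib,
            Finset.prod_mul_distrib, Finset.prod_const, Finset.prod_const,
            Finset.prod_pow_eq_pow_sum, hsumA, ← Real.exp_nat_mul]
          congr 3; ring
  have h3 := (Stirling.le_factorial_stirling n).trans
    (h1.trans (mul_le_mul_of_nonneg_left h2 (Nat.cast_nonneg _)))
  obtain ⟨d, hd⟩ : ∃ d, A.card = d + 1 := ⟨A.card - 1, by have := hA.card_pos; omega⟩
  rw [hd, Nat.add_sub_cancel]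
  rw [hd, Real.sqrt_mul (by positivity), div_pow, ← mul_div_assoc, ← mul_div_assoc,
    div_le_div_iff_of_pos_right (by positivity), pow_succ] at h3
  refine le_of_mul_le_mul_left ?_ (show 0 < √(2 * Real.pi) by positivity)
  linarith

/-! ### Pointwise density bound -/

/-- The output density of a channel fed with a uniformly random word of a given composition,
relative to the product of the output marginals, is bounded by a constant. -/
theorem sum_prod_channel_le {ι : Type} {κ : Type*} [Fintype ι] [Nonempty ι] [DecidableEq ι]
    [Fintype κ] [DecidableEq κ] (N : κ → ℕ) (A : Finset κ) (hNA : ∀ a, a ∈ A ↔ 0 < N a)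
    (hN : ∑ a, N a = Fintype.card ι) (c : ℝ) (hc : 0 < c) (hc1 : c ≤ 1)
    (g : ι → κ → ℝ) (hg : ∀ t a, 0 < g t a) (hcg : ∀ t a b, c * g t b ≤ g t a) :
    ∑ x ∈ wordsWithCounts ι A N, ∏ t, g t (x t) ≤
      (wordsWithCounts ι A N).card *
        (Real.exp (((Fintype.card κ : ℝ) - 1) / 2 * Real.log (2 * Real.pi / c)
            + (Fintype.card κ : ℝ) / 12) *
          ∏ t, ∑ a, (N a : ℝ) / Fintype.card ι * g t a) := by
  set n := Fintype.card ι with hn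
  have hn0 : (0 : ℝ) < n := by exact_mod_cast (Fintype.card_pos : 0 < Fintype.card ι)
  have hNz : ∀ a, a ∉ A → N a = 0 := fun a ha => by
    by_contra h; exact ha ((hNA a).2 (Nat.pos_of_ne_zero h))
  have hsumA : ∑ a ∈ A, N a = n := by
    rw [← hN]
    exact Finset.sum_subset (Finset.subset_univ A) fun a _ ha => hNz a ha
  have hA : A.Nonempty := by
    by_contra h
    rw [Finset.not_nonempty_iff_eq_empty.1 h, Finset.sum_empty] at hsumA
    rw [← hsumA] at hn0
    simp at hn0
  have h1 := sum_wordsWithCounts_le N c hc A hA (fun a => (hNA a).1) ι g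
    (fun t a _ => hg t a) (fun t a _ b _ => hcg t a b) hsumA
  have h2 := stirling_card_wordsWithCounts N A hA hNA hN
  rw [← hn] at h1 h2
  have hPY : ∏ t, ∑ a ∈ A, (N a : ℝ) * g t a
      = (n : ℝ) ^ n * ∏ t, ∑ a, (N a : ℝ) / n * g t a := by
    have hcst : (n : ℝ) ^ n = ∏ _t : ι, (n : ℝ) := by
      rw [Finset.prod_const, Finset.card_univ]
    rw [hcst, ← Finset.prod_mul_distrib]
    refine Finset.prod_congr rfl fun t _ => ?_
    rw [Finset.mul_sum, Finset.sum_subset (Finset.subset_univ A) fun a _ ha => by simp [hNz a ha]]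
    refine Finset.sum_congr rfl fun a _ => ?_
    field_simp
  -- The weights N_a contribute the same factor to every word of the class.
  have hL : ∑ x ∈ wordsWithCounts ι A N, ∏ t, ((N (x t) : ℝ) * g t (x t))
      = (∏ a ∈ A, (N a : ℝ) ^ N a) * ∑ x ∈ wordsWithCounts ι A N, ∏ t, g t (x t) := by
    rw [Finset.mul_sum]
    refine Finset.sum_congr rfl fun x hx => ?_
    rw [Finset.prod_mul_distrib, prod_comp_of_mem_wordsWithCounts hx fun a => (N a : ℝ)]
  rw [hL, hPY] at h1
  set Y := ∏ t, ∑ a, (N a : ℝ) / n * g t a with hY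
  have hY0 : 0 ≤ Y := Finset.prod_nonneg fun t _ => Finset.sum_nonneg fun a _ =>
    mul_nonneg (by positivity) (hg t a).le
  set L := ∏ a ∈ A, (N a : ℝ) ^ N a with hLdef
  have hL0 : 0 < L := Finset.prod_pos fun a ha => by
    have := (hNA a).1 ha; positivity
  set B := ∏ a ∈ A, √(N a : ℝ) with hB
  have hB0 : 0 < B := Finset.prod_pos fun a ha => by
    have := (hNA a).1 ha; positivity
  set C := ((wordsWithCounts ι A N).card : ℝ)
  have hAcard : (A.card : ℝ) ≤ Fintype.card κ := by
    exact_mod_cast Finset.card_le_univ A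
  obtain ⟨d, hd⟩ : ∃ d, A.card = d + 1 := ⟨A.card - 1, by have := hA.card_pos; omega⟩
  -- Nonnegativity lets the support size be replaced by the alphabet size in the exponent.
  have hlog : 0 ≤ Real.log (2 * Real.pi / c) := by
    refine Real.log_nonneg ((one_le_div hc).2 ?_)
    linarith [Real.pi_gt_three]
  have hE : (1 / √c) ^ (A.card - 1) * √(2 * Real.pi) ^ (A.card - 1) * Real.exp (A.card / 12)
      ≤ Real.exp (((Fintype.card κ : ℝ) - 1) / 2 * Real.log (2 * Real.pi / c)
            + (Fintype.card κ : ℝ) / 12) := by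
    have e1 : 1 / √c * √(2 * Real.pi) = Real.exp (1 / 2 * Real.log (2 * Real.pi / c)) := by
      rw [one_div_mul_eq_div, ← Real.sqrt_div' _ hc.le, Real.sqrt_eq_rpow,
        Real.rpow_def_of_pos (by positivity), mul_comm]
    rw [← mul_pow, e1, ← Real.exp_nat_mul, ← Real.exp_add]
    refine Real.exp_le_exp.2 (add_le_add ?_ (by linarith))
    rw [← mul_assoc]
    refine mul_le_mul_of_nonneg_right ?_ hlog
    rw [hd] at hAcard ⊢
    rw [Nat.add_sub_cancel]
    push_cast at hAcard
    linarith
  refine le_of_mul_le_mul_left ?_ hL0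
  calc _ ≤ _ := h1
    _ = (1 / √c) ^ (A.card - 1) * (√n * (n : ℝ) ^ n) / B * Y := by ring
    _ ≤ (1 / √c) ^ (A.card - 1) * (C * (√(2 * Real.pi) ^ (A.card - 1) * B * L *
          Real.exp (A.card / 12))) / B * Y := by gcongr
    _ = L * (C * (((1 / √c) ^ (A.card - 1) * √(2 * Real.pi) ^ (A.card - 1)
          * Real.exp (A.card / 12)) * Y)) := by field_simp
    _ ≤ _ := by gcongr

/-! ### Divergence and channels on finite alphabets -/

theorem klDiv_fintype {α : Type*} [Fintype α] [MeasurableSpace α] [MeasurableSingletonClass α]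
    (μ ν : Measure α) [IsProbabilityMeasure μ] [IsProbabilityMeasure ν]
    (h : ∀ y, 0 < ν.real {y}) :
    klDiv μ ν = ENNReal.ofReal (∑ y, μ.real {y} * Real.log (μ.real {y} / ν.real {y})) := by
  have hν : ∀ y, ν {y} ≠ 0 := fun y h0 => by
    have := h y; simp [Measure.real, h0] at this
  have hac : μ ≪ ν := by
    intro s hs
    have : s = ∅ := by
      by_contra hne
      obtain ⟨y, hy⟩ := Set.nonempty_iff_ne_empty.2 hne
      exact hν y (measure_mono_null (Set.singleton_subset_iff.2 hy) hs)
    simp [this]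
  rw [klDiv_of_ac_of_integrable hac Integrable.of_finite]
  simp only [probReal_univ, add_sub_cancel_right]
  rw [integral_fintype Integrable.of_finite]
  congr 1
  refine Finset.sum_congr rfl fun y _ => ?_
  have hr : μ {y} = μ.rnDeriv ν y * ν {y} := by
    conv_lhs => rw [← Measure.withDensity_rnDeriv_eq μ ν hac]
    rw [withDensity_apply _ (measurableSet_singleton y), lintegral_singleton]
  have : μ.real {y} / ν.real {y} = (μ.rnDeriv ν y).toReal := by
    rw [div_eq_iff (h y).ne', Measure.real, hr, ENNReal.toReal_mul, Measure.real]
  rw [this, llr, smul_eq_mul]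

/-- Gibbs' inequality, termwise from log x ≤ x − 1 at x = ν/μ. -/
theorem sum_mul_log_div_nonneg {α : Type*} [Fintype α] [MeasurableSpace α]
    [MeasurableSingletonClass α] (μ ν : Measure α) [IsProbabilityMeasure μ]
    [IsProbabilityMeasure ν] (h : ∀ y, 0 < ν.real {y}) :
    0 ≤ ∑ y, μ.real {y} * Real.log (μ.real {y} / ν.real {y}) := by
  have key : ∀ y, μ.real {y} - ν.real {y} ≤ μ.real {y} * Real.log (μ.real {y} / ν.real {y}) := by
    intro y
    rcases (measureReal_nonneg (μ := μ) (s := {y})).eq_or_lt with h0 | h0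
    · rw [← h0]; simp
    · have := Real.log_le_sub_one_of_pos (div_pos (h y) h0)
      rw [← inv_div, Real.log_inv]
      have e : μ.real {y} * (ν.real {y} / μ.real {y} - 1) = ν.real {y} - μ.real {y} := by
        field_simp
      nlinarith [mul_le_mul_of_nonneg_left this h0.le]
  have h1 : ∀ (ρ : Measure α) [IsProbabilityMeasure ρ], ∑ y, ρ.real {y} = 1 := fun ρ _ => by
    simp
  calc (0 : ℝ) = ∑ y, (μ.real {y} - ν.real {y}) := by
        rw [Finset.sum_sub_distrib, h1, h1, sub_self]
    _ ≤ _ := Finset.sum_le_sum fun y _ => key y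

theorem comp_real_singleton {α β : Type*} [Fintype α] [MeasurableSpace α]
    [MeasurableSingletonClass α] [MeasurableSpace β] [MeasurableSingletonClass β]
    (κ : Kernel α β) [IsMarkovKernel κ] (μ : Measure α) [IsProbabilityMeasure μ] (y : β) :
    (κ ∘ₘ μ).real {y} = ∑ x, μ.real {x} * (κ x).real {y} := by
  rw [Measure.real, Measure.bind_apply (measurableSet_singleton y) κ.aemeasurable,
    lintegral_fintype, ENNReal.toReal_sum fun x _ => ENNReal.mul_ne_top (by simp) (by simp)]
  simp [Measure.real, mul_comm]

theorem uniformOn_real_singleton {α : Type*} [Fintype α] [DecidableEq α] [MeasurableSpace α]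
    [MeasurableSingletonClass α] (T : Finset α) (x : α) :
    (uniformOn (T : Set α)).real {x} = if x ∈ T then (T.card : ℝ)⁻¹ else 0 := by
  rw [Measure.real, uniformOn, cond_apply (Finset.measurableSet T)]
  by_cases h : x ∈ T
  · have : (T : Set α) ∩ {x} = {x} := by simpa using h
    simp [h, this, Measure.count_apply_finset]
  · have : (T : Set α) ∩ {x} = ∅ := by simpa using h
    simp [h, this]

instance {q k : ℕ} (W : Kernel (Fin q) (Fin k)) [IsMarkovKernel W] (n : ℕ) :
    IsMarkovKernel (channelPow W n) :=
  ⟨fun x => inferInstanceAs (IsProbabilityMeasure (Measure.pi fun t : Fin n => W (x t)))⟩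

theorem pi_real_singleton {ι α : Type*} [Fintype ι] [MeasurableSpace α]
    (μ : ι → Measure α) [∀ i, IsProbabilityMeasure (μ i)] (y : ι → α) :
    (Measure.pi μ).real {y} = ∏ i, (μ i).real {y i} := by
  rw [Measure.real, Measure.pi_singleton, ENNReal.toReal_prod]
  rfl

theorem sum_pi_real_mul_comp_eval {ι α : Type*} [Fintype ι] [DecidableEq ι] [Fintype α]
    [MeasurableSpace α]
    [MeasurableSingletonClass α] (μ : ι → Measure α) [∀ i, IsProbabilityMeasure (μ i)]
    (φ : α → ℝ) (s : ι) :
    ∑ y : ι → α, (Measure.pi μ).real {y} * φ (y s) = ∑ b, (μ s).real {b} * φ b := by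
  have h := integral_comp_eval (μ := μ) (i := s) (f := φ)
    (StronglyMeasurable.of_discrete).aestronglyMeasurable
  rw [integral_fintype Integrable.of_finite, integral_fintype Integrable.of_finite] at h
  simpa using h

theorem nonempty_output {q k : ℕ} (W : Kernel (Fin q) (Fin k)) [IsMarkovKernel W] (x : Fin q) :
    Nonempty (Fin k) :=
  (W x).nonempty_of_neZero

/-! ### The ratio c_* -/

section minRatio

variable {q k : ℕ} (W : Kernel (Fin q) (Fin k)) [IsMarkovKernel W]

theorem minRatio_mul_le (hW : ∀ (x : Fin q) (y : Fin k), 0 < W x {y}) (y : Fin k)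
    (a b : Fin q) : minRatio W * (W b).real {y} ≤ (W a).real {y} := by
  have hpos : ∀ x, 0 < (W x).real {y} := fun x => ENNReal.toReal_pos (hW x y).ne' (by simp)
  have hs : (W b).real {y} ≤ ⨆ x, (W x).real {y} :=
    le_ciSup (f := fun x => (W x).real {y}) (Set.finite_range _).bddAbove b
  have hi : (⨅ x, (W x).real {y}) ≤ (W a).real {y} :=
    ciInf_le (f := fun x => (W x).real {y}) (Set.finite_range _).bddBelow a
  have hi0 : 0 ≤ ⨅ x, (W x).real {y} := Real.iInf_nonneg fun x => (hpos x).le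
  have hr : minRatio W ≤ (⨅ x, (W x).real {y}) / ⨆ x, (W x).real {y} :=
    ciInf_le (f := fun y => (⨅ x, (W x).real {y}) / ⨆ x, (W x).real {y})
      (Set.finite_range _).bddBelow y
  have hs0 := (hpos b).trans_le hs
  calc _ ≤ (⨅ x, (W x).real {y}) / (⨆ x, (W x).real {y}) * (⨆ x, (W x).real {y}) :=
        mul_le_mul hr hs (hpos b).le (div_nonneg hi0 hs0.le)
    _ = ⨅ x, (W x).real {y} := div_mul_cancel₀ _ hs0.ne'
    _ ≤ _ := hi


theorem minRatio_pos (hq : 0 < q) (hW : ∀ (x : Fin q) (y : Fin k), 0 < W x {y}) :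
    0 < minRatio W := by
  have : Nonempty (Fin q) := ⟨⟨0, hq⟩⟩
  have : Nonempty (Fin k) := nonempty_output W ⟨0, hq⟩
  have hpos : ∀ x y, 0 < (W x).real {y} := fun x y => ENNReal.toReal_pos (hW x y).ne' (by simp)
  obtain ⟨y, hy⟩ := exists_eq_ciInf_of_finite
    (f := fun y => (⨅ x, (W x).real {y}) / ⨆ x, (W x).real {y})
  obtain ⟨x, hx⟩ := exists_eq_ciInf_of_finite (f := fun x => (W x).real {y})
  rw [minRatio, ← hy]
  refine div_pos (hx ▸ hpos x y) ((hpos x y).trans_le ?_)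
  exact le_ciSup (f := fun x => (W x).real {y}) (Set.finite_range _).bddAbove x

theorem minRatio_le_one (hq : 0 < q) (hW : ∀ (x : Fin q) (y : Fin k), 0 < W x {y}) :
    minRatio W ≤ 1 := by
  obtain ⟨y⟩ := nonempty_output W ⟨0, hq⟩
  have hpos : 0 < (W ⟨0, hq⟩).real {y} := ENNReal.toReal_pos (hW _ y).ne' (by simp)
  refine le_of_mul_le_mul_right ?_ hpos
  rw [one_mul]
  exact minRatio_mul_le W hW y ⟨0, hq⟩ ⟨0, hq⟩

end minRatio

/-! ### Type classes and their output laws -/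

theorem IsNType.exists_counts {q n : ℕ} (hn : 0 < n) {P : Measure (Fin q)}
    [IsProbabilityMeasure P] (hP : IsNType n P) :
    ∃ N : Fin q → ℕ, (∀ a, P.real {a} = N a / n) ∧ ∑ a, N a = n ∧
      typeClass n P = wordsWithCounts (Fin n) (Finset.univ.filter fun a => 0 < N a) N := by
  choose N hN using hP
  have hn' : (n : ℝ) ≠ 0 := by positivity
  refine ⟨N, hN, ?_, ?_⟩
  · have h : ∑ a, P.real {a} = 1 := by simp
    simp_rw [hN] at h
    rw [← Finset.sum_div, div_eq_one_iff_eq hn'] at h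
    exact_mod_cast h
  · ext x
    rw [Finset.mem_coe, mem_wordsWithCounts]
    simp only [typeClass, Set.mem_ofPred_eq, hN, div_left_inj' hn', Nat.cast_inj,
      Finset.mem_filter, Finset.mem_univ, true_and]
    refine ⟨fun h => ⟨fun t => ?_, fun a _ => h a⟩, fun h a => ?_⟩
    · rw [← h (x t), Finset.card_pos]
      exact ⟨t, by simp⟩
    · rcases Nat.eq_zero_or_pos (N a) with h0 | h0
      · rw [h0, Finset.card_eq_zero, Finset.filter_eq_empty_iff]
        rintro t _ rfl
        exact (h.1 t).ne' h0
      · exact h.2 a h0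

/-- An empty class would turn the Stirling bound into √n nⁿ ≤ 0. -/
theorem wordsWithCounts_nonempty {q n : ℕ} {N : Fin q → ℕ} {A : Finset (Fin q)} (hn : 0 < n)
    (hNA : ∀ a, a ∈ A ↔ 0 < N a) (hN : ∑ a, N a = n) :
    (wordsWithCounts (Fin n) A N).Nonempty := by
  by_contra h
  have hA : A.Nonempty := by
    by_contra hA
    have : ∑ a, N a = 0 := Finset.sum_eq_zero fun a _ => by
      by_contra h0
      exact hA ⟨a, (hNA a).2 (Nat.pos_of_ne_zero h0)⟩
    omega
  have h2 := stirling_card_wordsWithCounts (ι := Fin n) N A hA hNA (by simpa using hN)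
  rw [Finset.not_nonempty_iff_eq_empty.1 h, Finset.card_empty, Nat.cast_zero, zero_mul,
    Fintype.card_fin] at h2
  have : (0 : ℝ) < √(n : ℝ) * (n : ℝ) ^ n := by positivity
  linarith

section

variable {q k : ℕ} (W : Kernel (Fin q) (Fin k)) [IsMarkovKernel W] {n : ℕ}
  {N : Fin q → ℕ} {A : Finset (Fin q)}

theorem channelPow_comp_uniformOn_real_singleton
    [IsProbabilityMeasure (uniformOn (wordsWithCounts (Fin n) A N : Set (Fin n → Fin q)))]
    (y : Fin n → Fin k) :
    (channelPow W n ∘ₘ uniformOn (wordsWithCounts (Fin n) A N : Set (Fin n → Fin q))).real {y}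
      = ((wordsWithCounts (Fin n) A N).card : ℝ)⁻¹
        * ∑ x ∈ wordsWithCounts (Fin n) A N, ∏ t, (W (x t)).real {y t} := by
  rw [comp_real_singleton, Finset.mul_sum, ← Finset.sum_subset (Finset.subset_univ _)]
  · refine Finset.sum_congr rfl fun x hx => ?_
    rw [uniformOn_real_singleton, if_pos hx]
    congr 1
    exact pi_real_singleton (fun t => W (x t)) y
  · intro x _ hx
    rw [uniformOn_real_singleton, if_neg hx, zero_mul]

/-- For each fixed input word the mean is a sum over positions, which depends on the word only
through its composition; averaging over the class changes nothing. -/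
theorem sum_channelPow_comp_uniformOn
    [IsProbabilityMeasure (uniformOn (wordsWithCounts (Fin n) A N : Set (Fin n → Fin q)))]
    (hne : (wordsWithCounts (Fin n) A N).Nonempty) (hNA : ∀ a, a ∈ A ↔ 0 < N a)
    (φ : Fin k → ℝ) :
    ∑ y, (channelPow W n ∘ₘ
        uniformOn (wordsWithCounts (Fin n) A N : Set (Fin n → Fin q))).real {y} * ∑ t, φ (y t)
      = ∑ a, N a * ∑ b, (W a).real {b} * φ b := by
  have hx : ∀ x ∈ wordsWithCounts (Fin n) A N,
      ∑ y : Fin n → Fin k, (∏ t, (W (x t)).real {y t}) * ∑ t, φ (y t)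
        = ∑ a, N a * ∑ b, (W a).real {b} * φ b := by
    intro x hx
    obtain ⟨h1, h2⟩ := mem_wordsWithCounts.1 hx
    simp_rw [← pi_real_singleton (fun t => W (x t)), Finset.mul_sum]
    rw [Finset.sum_comm]
    simp_rw [sum_pi_real_mul_comp_eval (fun t => W (x t)) φ, ← Finset.mul_sum]
    rw [← Finset.sum_fiberwise_of_maps_to (t := A) (g := x) (fun t _ => h1 t),
      ← Finset.sum_subset (Finset.subset_univ A)]
    · refine Finset.sum_congr rfl fun a ha => ?_
      rw [← h2 a ha, ← nsmul_eq_mul, ← Finset.sum_const]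
      exact Finset.sum_congr rfl fun t ht => by rw [(Finset.mem_filter.1 ht).2]
    · intro a _ ha
      have : N a = 0 := by
        by_contra h; exact ha ((hNA a).2 (Nat.pos_of_ne_zero h))
      simp [this]
  have hc : ((wordsWithCounts (Fin n) A N).card : ℝ) ≠ 0 := by
    exact_mod_cast hne.card_pos.ne'
  calc _ = ∑ y : Fin n → Fin k, ((wordsWithCounts (Fin n) A N).card : ℝ)⁻¹
        * ∑ x ∈ wordsWithCounts (Fin n) A N, (∏ t, (W (x t)).real {y t}) * ∑ t, φ (y t) := by
        refine Finset.sum_congr rfl fun y _ => ?_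
        rw [channelPow_comp_uniformOn_real_singleton, ← Finset.sum_mul, mul_assoc]
    _ = ((wordsWithCounts (Fin n) A N).card : ℝ)⁻¹ * ∑ x ∈ wordsWithCounts (Fin n) A N,
          ∑ y : Fin n → Fin k, (∏ t, (W (x t)).real {y t}) * ∑ t, φ (y t) := by
        rw [← Finset.mul_sum, Finset.sum_comm]
    _ = _ := by
        rw [Finset.sum_congr rfl hx, Finset.sum_const, nsmul_eq_mul, inv_mul_cancel_left₀ hc]

end

theorem klDiv_eq_top_of_singleton {α : Type*} [MeasurableSpace α] {μ ν : Measure α} {y : α}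
    (hμ : μ {y} ≠ 0) (hν : ν {y} = 0) : klDiv μ ν = ∞ :=
  klDiv_of_not_ac fun h => hμ (h hν)

/-! ### The two divergence bounds -/

theorem theorem2 :
    ∃ α : ℝ, 0 < α ∧
      ∀ (q k : ℕ), 0 < q →
        ∀ (W : Kernel (Fin q) (Fin k)) [IsMarkovKernel W],
          (∀ (x : Fin q) (y : Fin k), 0 < W x {y}) →
          ∃ c : ℝ≥0,
            (c : ℝ) ≤ ((q : ℝ) - 1) / 2 * Real.log (2 * Real.pi * α ^ 2 / minRatio W)
              + (q : ℝ) / 12 ∧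
            ∀ (n : ℕ), 0 < n →
              ∀ (P : Measure (Fin q)) [IsProbabilityMeasure P], IsNType n P →
                ∀ (Q : Measure (Fin k)) [IsProbabilityMeasure Q],
                  (n : ℝ≥0∞) * klDiv (W ∘ₘ P) Q
                      ≤ klDiv (channelPow W n ∘ₘ uniformOn (typeClass n P))
                          (Measure.pi (fun _ : Fin n => Q)) ∧
                  klDiv (channelPow W n ∘ₘ uniformOn (typeClass n P))
                          (Measure.pi (fun _ : Fin n => Q))
                      ≤ (n : ℝ≥0∞) * klDiv (W ∘ₘ P) Q + (c : ℝ≥0∞) := by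
  -- α is the constant in the bound α/σ of `poissonBinomial_le`, which is 1.
  refine ⟨1, one_pos, fun q k hq W _ hW => ?_⟩
  have hr0 := minRatio_pos W hq hW
  have hr1 := minRatio_le_one W hq hW
  set C : ℝ := ((q : ℝ) - 1) / 2 * Real.log (2 * Real.pi / minRatio W) + (q : ℝ) / 12 with hC
  have hC0 : 0 ≤ C := by
    have h1 : (1 : ℝ) ≤ q := by exact_mod_cast hq
    have h2 : 0 ≤ Real.log (2 * Real.pi / minRatio W) := by
      refine Real.log_nonneg ((one_le_div hr0).2 ?_)
      linarith [Real.pi_gt_three]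
    have : 0 ≤ ((q : ℝ) - 1) / 2 := by linarith
    positivity
  refine ⟨NNReal.mk C hC0, by rw [one_pow, mul_one]; exact le_rfl, fun n hn P _ hP Q _ => ?_⟩
  have hWr : ∀ x y, 0 < (W x).real {y} := fun x y => ENNReal.toReal_pos (hW x y).ne' (by simp)
  obtain ⟨N, hPN, hNn, hT⟩ := hP.exists_counts hn
  set A := Finset.univ.filter fun a => 0 < N a with hA
  have hNA : ∀ a, a ∈ A ↔ 0 < N a := fun a => by simp [hA]
  have hn' : (0 : ℝ) < n := by exact_mod_cast hn
  have : Nonempty (Fin n) := ⟨⟨0, hn⟩⟩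
  have hne := wordsWithCounts_nonempty hn hNA hNn
  have hcard : (0 : ℝ) < (wordsWithCounts (Fin n) A N).card := by exact_mod_cast hne.card_pos
  rw [hT]
  have : IsProbabilityMeasure
      (uniformOn (wordsWithCounts (Fin n) A N : Set (Fin n → Fin q))) :=
    isProbabilityMeasure_uniformOn (Finset.finite_toSet _) (by simpa using hne)
  set R := channelPow W n ∘ₘ uniformOn (wordsWithCounts (Fin n) A N : Set (Fin n → Fin q))
    with hR
  have hRy := channelPow_comp_uniformOn_real_singleton W (n := n) (N := N) (A := A)
  rw [← hR] at hRy
  have hRpos : ∀ y, 0 < R.real {y} := fun y => by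
    rw [hRy]
    exact mul_pos (inv_pos.2 hcard)
      (Finset.sum_pos (fun x _ => Finset.prod_pos fun t _ => hWr _ _) hne)
  have hYy : ∀ b, (W ∘ₘ P).real {b} = ∑ a, (N a : ℝ) / n * (W a).real {b} := fun b => by
    simp_rw [comp_real_singleton, hPN]
  have hYpos : ∀ b, 0 < (W ∘ₘ P).real {b} := fun b => by
    rw [hYy]
    obtain ⟨a, ha⟩ : ∃ a, N a ≠ 0 := by
      by_contra! h
      simp [h] at hNn
      omega
    refine Finset.sum_pos' (fun a _ => mul_nonneg (by positivity) (hWr a b).le)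
      ⟨a, Finset.mem_univ a, mul_pos (by positivity) (hWr a b)⟩
  -- Both output laws have full support, so if Q misses a letter b, both divergences are infinite;
  -- the constant word b shows it for the n-fold product.
  by_cases hQ : ∀ b, 0 < Q.real {b}
  swap
  · push Not at hQ
    obtain ⟨b, hb⟩ := hQ
    have hQb : Q {b} = 0 := by
      have := le_antisymm hb measureReal_nonneg
      rwa [measureReal_eq_zero_iff] at this
    have h1 : klDiv (W ∘ₘ P) Q = ∞ :=
      klDiv_eq_top_of_singleton (fun h => (hYpos b).ne' (by simp [Measure.real, h])) hQb
    have h2 : klDiv R (Measure.pi fun _ : Fin n => Q) = ∞ := by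
      refine klDiv_eq_top_of_singleton (y := fun _ => b)
        (fun h => (hRpos fun _ => b).ne' (by simp [Measure.real, h])) ?_
      rw [Measure.pi_singleton]
      simp [hQb, hn.ne']
    rw [h1, h2, ENNReal.mul_top (by exact_mod_cast hn.ne')]
    simp
  · have hpiQ : ∀ y, (Measure.pi fun _ : Fin n => Q).real {y} = ∏ t, Q.real {y t} :=
      fun y => pi_real_singleton (fun _ => Q) y
    have hpiY : ∀ y, (Measure.pi fun _ : Fin n => (W ∘ₘ P)).real {y}
        = ∏ t, (W ∘ₘ P).real {y t} := fun y => pi_real_singleton (fun _ => (W ∘ₘ P)) y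
    have hpiQ0 : ∀ y, 0 < (Measure.pi fun _ : Fin n => Q).real {y} := fun y => by
      rw [hpiQ]; exact Finset.prod_pos fun t _ => hQ _
    have hpiY0 : ∀ y, 0 < (Measure.pi fun _ : Fin n => (W ∘ₘ P)).real {y} := fun y => by
      rw [hpiY]; exact Finset.prod_pos fun t _ => hYpos _
    rw [klDiv_fintype _ _ hQ, klDiv_fintype _ _ hpiQ0]
    -- The excess D(R‖P_Yⁿ), to be placed between 0 and C.
    set E := ∑ y, R.real {y} * Real.log (R.real {y} /
      (Measure.pi fun _ : Fin n => (W ∘ₘ P)).real {y}) with hE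
    have hE0 : 0 ≤ E := sum_mul_log_div_nonneg R _ hpiY0
    have hEC : E ≤ C := by
      calc E ≤ ∑ y, R.real {y} * C := by
            refine Finset.sum_le_sum fun y _ => mul_le_mul_of_nonneg_left ?_ (hRpos y).le
            rw [Real.log_le_iff_le_exp (div_pos (hRpos y) (hpiY0 y)),
              div_le_iff₀ (hpiY0 y), hRy, hpiY, inv_mul_le_iff₀ hcard]
            have := sum_prod_channel_le (ι := Fin n) N A hNA (by simpa using hNn) (minRatio W)
              hr0 hr1 (fun t a => (W a).real {y t}) (fun t a => hWr a _)
              (fun t a b => minRatio_mul_le W hW (y t) a b)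
            simpa only [Fintype.card_fin, hYy, hC] using this
        _ = C := by rw [← Finset.sum_mul]; simp
    have hsplit : ∑ y, R.real {y} * Real.log (R.real {y} /
          (Measure.pi fun _ : Fin n => Q).real {y})
        = n * (∑ b, (W ∘ₘ P).real {b} * Real.log ((W ∘ₘ P).real {b} / Q.real {b})) + E := by
      have h1 := sum_channelPow_comp_uniformOn W hne hNA
        fun b => Real.log ((W ∘ₘ P).real {b} / Q.real {b})
      rw [← hR] at h1
      have h2 : n * (∑ b, (W ∘ₘ P).real {b} * Real.log ((W ∘ₘ P).real {b} / Q.real {b}))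
          = ∑ a, N a * ∑ b, (W a).real {b} * Real.log ((W ∘ₘ P).real {b} / Q.real {b}) := by
        simp_rw [Finset.mul_sum]
        rw [Finset.sum_comm]
        refine Finset.sum_congr rfl fun b _ => ?_
        conv_lhs => rw [hYy b, Finset.sum_mul, Finset.mul_sum]
        refine Finset.sum_congr rfl fun a _ => ?_
        rw [← hYy b]
        field_simp
      rw [h2, ← h1, hE, ← Finset.sum_add_distrib]
      refine Finset.sum_congr rfl fun y _ => ?_
      rw [← mul_add]
      congr 1
      rw [← Real.log_prod fun t _ => (div_pos (hYpos _) (hQ _)).ne', Finset.prod_div_distrib,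
        ← hpiQ, ← hpiY, ← Real.log_mul (div_pos (hpiY0 y) (hpiQ0 y)).ne'
          (div_pos (hRpos y) (hpiY0 y)).ne']
      have := (hpiY0 y).ne'
      have := (hpiQ0 y).ne'
      congr 1
      field_simp
    have hD0 := sum_mul_log_div_nonneg (W ∘ₘ P) Q hQ
    rw [hsplit, ENNReal.ofReal_add (by positivity) hE0, ENNReal.ofReal_mul hn'.le,
      ENNReal.ofReal_natCast]
    refine ⟨le_self_add, add_le_add le_rfl ?_⟩
    refine (ENNReal.ofReal_le_ofReal hEC).trans_eq ?_
    rw [ENNReal.ofReal_eq_coe_nnreal hC0]
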